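/- **Setting.** Let $n\ge 1$ and let $W=(w_{ij})$ be a symmetric $n\times n$ matrix of non-negative similarities, $D$ the diagonal matrix with $d_i=\sum_j w_{ij}$, $L=D-W$ the graph Laplacian and $\lambda_M(L)$ its largest eigenvalue. Let $y_1,\dots,y_n\in\{-1,1\}$ be the true labels of the $n$ vertices, $\gamma_g\ge 0$ and $0<c_u<1$. For a set $l$ of labeled vertices let $C$ be the diagonal matrix with $C_{ii}=1$ for $i\in l$ and $C_{ii}=c_u$ otherwise, let $\mathbf y^{l}$ be the vector of pseudo-targets ($y^{l}_i=y_i$ for $i\in l$ and $y^{l}_i=0$ otherwise), and let $\ell^\ast$ be a solution of $$\min_{\ell\in\mathbb R^n}\ (\ell-\mathbf y^{l})^{\mathsf T}C(\ell-\mathbf y^{l})+\ell^{\mathsf T}(L+\gamma_g I)\ell .$$ For a sample $S=(s_1,\dots,s_{n_l})$ of $n_l\ge 1$ vertices, whose labeled set is $l=\{s_1,\dots,s_{n_l}\}$, put $$R(\ell^\ast)=\frac1n\sum_{i=1}^n(\ell^\ast_i-y_i)^2,\qquad \widehat R(\ell^\ast)=\frac1{n_l}\sum_{k=1}^{n_l}(\ell^\ast_{s_k}-y_{s_k})^2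 .$$ Let $\beta$ be the uniform stability coefficient of the solution, i.e. the supremum of $|(\ell^\ast_i-y_i)^2-(\ell'^{\ast}_i-y_i)^2|$ over all vertices $i$ and all pairs of samples of size $n_l$ that differ in at most one example, with solutions $\ell^\ast$ and $\ell'^\ast$. For $a>0$ let $$B_a=2\left[\frac{a}{\gamma_g+1}+\sqrt{2n_l}\,\frac{1-\sqrt{c_u}}{\sqrt{c_u}}\,\frac{\lambda_M(L)+\gamma_g}{\gamma_g^2+1}\right],\qquad \Delta_T(\beta,n_l,\delta)=\beta+\sqrt{\frac{2\ln(2/\delta)}{n_l}}\,(n_l\beta+4).$$ **Lemma.** 1. For every labeled set the solution $\ell^\ast$ exists and is unique, and the supremum $\beta$ is finite. 2. $\beta\le B_2$ always, and $\beta\le B_{\sqrt2}$ whenever $\lambda_M(L)+\gamma_g\ge 1$. 3. If the labeled examples $s_1,\dots,s_{n_l}$ are selected i.i.d. uniformly from the $n$ vertices and $0<\delta<1$, then with probability at least $1-\delta$ $$R(\ell^\ast)\le\widehat R(\ell^\ast)+\Delta_T(\beta,n_l,\delta),$$ and likewise with probability at least $1-\delta$, $R(\ell^\ast)\le\widehat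 R(\ell^\ast)+\Delta_T(B_{\sqrt2},n_l,\delta)$ (without any condition on $\lambda_M(L)+\gamma_g$). 4. $\beta=O(1/n_l)$ when $\gamma_g=\Omega(n_l^{3/2})$: for every $\kappa>0$ there is a $K$, depending on $\kappa$ only, such that $\beta\le K/n_l$ for every such problem with $\gamma_g\ge\kappa n_l^{3/2}$. The same holds for $B_{\sqrt2}$ in place of $\beta$, with $K$ depending on $\kappa$, $c$ and $M$ only, for all problems with moreover $c_u\ge c>0$ and $\lambda_M(L)\le M\gamma_g$. -/

import Mathlib

open MeasureTheory ProbabilityTheory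

/-- A soft harmonic problem on the vertices `0, …, n - 1`: a weighted data adjacency graph with
symmetric non-negative similarities `W`, the true labels `y i ∈ {-1, 1}` of all vertices, the weight
`cu` of the unlabeled vertices (labeled vertices have weight `1 > cu`) and the regularizer `γ`. -/
structure SoftHarmonicProblem (n : ℕ) where
  W : Matrix (Fin n) (Fin n) ℝ
  W_symm : ∀ i j, W i j = W j i
  W_nonneg : ∀ i j, 0 ≤ W i j
  y : Fin n → ℝ
  y_mem : ∀ i, y i = -1 ∨ y i = 1
  cu : ℝ
  cu_pos : 0 < cu
  cu_lt_one : cu < 1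
  γ : ℝ
  γ_nonneg : 0 ≤ γ

noncomputable section

namespace SoftHarmonicProblem

open scoped Classical in
/-- The diagonal of `C`: weight `1` on the labeled set `l` and `cu` elsewhere. -/
def weight {n : ℕ} (p : SoftHarmonicProblem n) (l : Set (Fin n)) (i : Fin n) : ℝ :=
  if i ∈ l then 1 else p.cu

open scoped Classical in
/-- The pseudo-targets: the true label on the labeled set `l` and `0` elsewhere. -/
def target {n : ℕ} (p : SoftHarmonicProblem n) (l : Set (Fin n)) (i : Fin n) : ℝ :=
  if i ∈ l then p.y i else 0

/-- The graph Laplacian `L = D - W`, where `D` is the diagonal matrix of the row sums of `W`. -/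
def laplacian {n : ℕ} (p : SoftHarmonicProblem n) : Matrix (Fin n) (Fin n) ℝ :=
  Matrix.diagonal (fun i => ∑ j, p.W i j) - p.W

/-- The largest eigenvalue of the (symmetric) Laplacian. -/
def lambdaMax {n : ℕ} (p : SoftHarmonicProblem n) : ℝ :=
  sSup {μ : ℝ | Module.End.HasEigenvalue (Matrix.toLin' p.laplacian) μ}

/-- `(ℓ - t)ᵀ C (ℓ - t) + ℓᵀ (L + γ I) ℓ`, where `t` is the vector of pseudo-targets. -/
def objective {n : ℕ} (p : SoftHarmonicProblem n) (l : Set (Fin n)) (ℓ : Fin n → ℝ) : ℝ :=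
  (ℓ - p.target l) ⬝ᵥ (Matrix.diagonal (p.weight l)).mulVec (ℓ - p.target l) +
    ℓ ⬝ᵥ (p.laplacian + p.γ • (1 : Matrix (Fin n) (Fin n) ℝ)).mulVec ℓ

/-- `ℓ` solves the soft harmonic problem whose labeled set is `l`. -/
def IsSolution {n : ℕ} (p : SoftHarmonicProblem n) (l : Set (Fin n)) (ℓ : Fin n → ℝ) : Prop :=
  ∀ ℓ' : Fin n → ℝ, p.objective l ℓ ≤ p.objective l ℓ'

/-- Squared error of the prediction `ℓ` at the vertex `i`. -/
def cost {n : ℕ} (p : SoftHarmonicProblem n) (ℓ : Fin n → ℝ) (i : Fin n) : ℝ :=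
  (ℓ i - p.y i) ^ 2

/-- Risk over all vertices. -/
def risk {n : ℕ} (p : SoftHarmonicProblem n) (ℓ : Fin n → ℝ) : ℝ :=
  (1 / (n : ℝ)) * ∑ i, p.cost ℓ i

/-- Empirical risk on a sample `S` of `nl` labeled vertices. -/
def empiricalRisk {n nl : ℕ} (p : SoftHarmonicProblem n) (S : Fin nl → Fin n)
    (ℓ : Fin n → ℝ) : ℝ :=
  (1 / (nl : ℝ)) * ∑ k, p.cost ℓ (S k)

/-- All the changes of the cost at a vertex that are caused by replacing one example of a sample
of `nl` labeled vertices. -/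
def costChanges {n : ℕ} (p : SoftHarmonicProblem n) (nl : ℕ) : Set ℝ :=
  {r | ∃ (S S' : Fin nl → Fin n) (ℓ ℓ' : Fin n → ℝ) (i : Fin n),
    (∃ k, ∀ j, j ≠ k → S j = S' j) ∧
    p.IsSolution (Set.range S) ℓ ∧ p.IsSolution (Set.range S') ℓ' ∧
    r = |p.cost ℓ i - p.cost ℓ' i|}

/-- The (uniform, replace-one) stability coefficient `β` of the soft harmonic solution. -/
def stability {n : ℕ} (p : SoftHarmonicProblem n) (nl : ℕ) : ℝ :=
  sSup (p.costChanges nl)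

/-- `2 [ a / (γ + 1) + √(2 nl) (1 - √cu) / √cu · (λ_max(L) + γ) / (γ² + 1) ]`. -/
def stabilityBound {n : ℕ} (p : SoftHarmonicProblem n) (nl : ℕ) (a : ℝ) : ℝ :=
  2 * (a / (p.γ + 1) +
    √(2 * (nl : ℝ)) * ((1 - √p.cu) / √p.cu) * ((p.lambdaMax + p.γ) / (p.γ ^ 2 + 1)))

end SoftHarmonicProblem

/-- The transductive error `Δ_T(β, nl, δ)`. -/
def transductiveError (β : ℝ) (nl : ℕ) (δ : ℝ) : ℝ :=
  β + √(2 * Real.log (2 / δ) / (nl : ℝ)) * ((nl : ℝ) * β + 4)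

end

/-!
The solution with labeled set `l` is `ℓ = (C + L + γ I)⁻¹ y^l`. The minimum and maximum principles
make the entries of this inverse, the Green function `G`, non-negative and largest on the
diagonal. Its row sums, weighted by the diagonal `C + γ I`, are `1`; hence the influences `G i v`
of the labeled vertices on a vertex `i` have total at most `m = 1 / (1 + γ)`, and `|ℓ i| ≤ m`.

When one example is replaced, write both solutions with the Green function of the union of the two
labeled sets, in which a vertex missing from one of them only causes an error of relative size
`ε = (1 - c_u) / (1 + γ)`. If `q` is the influence of the exchanged vertices, then `y_i ℓ_i` drops
by at most `(1 + ε) q`, and since `G i i` dominates the influence of the new vertex, the two values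
of `y_i ℓ_i` add up to at least `2 q - 2 m`. The change of `(1 - y_i ℓ_i) ^ 2` is therefore at
most `(1 + ε) q (2 - 2 q + 2 m) ≤ 2 (1 + ε) m`, which bounds `β` and implies both explicit bounds.

The gap between risk and empirical risk has mean at most `β`, because an example of the sample may
be exchanged with a fresh one, and replacing an example changes it by at most `2 β + 4 / n_l`. It
is thus sub-Gaussian, by conditioning on one example at a time (McDiarmid), and Chernoff's bound
gives the tail.
-/

open scoped Matrix NNReal

section Quadratic

variable {ι : Type*} [Fintype ι] [DecidableEq ι] {A : Matrix ι ι ℝ}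

theorem quadratic_eq_add_completed_square (hA : A.PosDef) (b v : ι → ℝ) :
    v ⬝ᵥ A *ᵥ v - 2 * (b ⬝ᵥ v) =
      (v - A⁻¹ *ᵥ b) ⬝ᵥ A *ᵥ (v - A⁻¹ *ᵥ b) - (A⁻¹ *ᵥ b) ⬝ᵥ b := by
  have hmul : A *ᵥ (A⁻¹ *ᵥ b) = b := by
    rw [Matrix.mulVec_mulVec, Matrix.mul_nonsing_inv _ (A.isUnit_iff_isUnit_det.1 hA.isUnit),
      Matrix.one_mulVec]
  have hsymm : (A⁻¹ *ᵥ b) ⬝ᵥ A *ᵥ v = b ⬝ᵥ v := by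
    rw [Matrix.dotProduct_mulVec, ← Matrix.mulVec_transpose,
      ← Matrix.conjTranspose_eq_transpose_of_trivial, hA.isHermitian.eq, hmul]
  rw [Matrix.mulVec_sub, hmul, sub_dotProduct, dotProduct_sub, dotProduct_sub, hsymm,
    dotProduct_comm v b]
  ring

theorem forall_quadratic_le_iff (hA : A.PosDef) {b u : ι → ℝ} :
    (∀ v, u ⬝ᵥ A *ᵥ u - 2 * (b ⬝ᵥ u) ≤ v ⬝ᵥ A *ᵥ v - 2 * (b ⬝ᵥ v)) ↔ u = A⁻¹ *ᵥ b := by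
  simp only [quadratic_eq_add_completed_square hA b, sub_le_sub_iff_right]
  constructor
  · intro hmin
    by_contra hne
    have hpos := hA.dotProduct_mulVec_pos (sub_ne_zero.2 hne)
    exact absurd (hmin (A⁻¹ *ᵥ b)) (by simpa using hpos)
  · rintro rfl v
    simpa using hA.posSemidef.dotProduct_mulVec_nonneg (v - A⁻¹ *ᵥ b)

end Quadratic

section Laplacian

variable {ι : Type*} [Fintype ι] [DecidableEq ι]

/-- The Laplacian `D - W` of the weighted graph with weight matrix `W`, for which the maximum
principle is stated; symmetry and non-negativity of `W` are left to the lemmas. -/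
def weightedLaplacian (W : Matrix ι ι ℝ) : Matrix ι ι ℝ :=
  Matrix.diagonal (fun i => ∑ j, W i j) - W

/-- The Laplacian of `W` with the killing rates `d` added on the diagonal. The matrix of the normal
equations has this form, and its inverse is the Green function of a killed random walk. -/
def screenedLaplacian (W : Matrix ι ι ℝ) (d : ι → ℝ) : Matrix ι ι ℝ :=
  Matrix.diagonal d + weightedLaplacian W

theorem weightedLaplacian_mulVec (W : Matrix ι ι ℝ) (u : ι → ℝ) (i : ι) :
    (weightedLaplacian W *ᵥ u) i = ∑ j, W i j * (u i - u j) := by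
  rw [weightedLaplacian, Matrix.sub_mulVec, Pi.sub_apply, Matrix.mulVec_diagonal, Finset.sum_mul]
  simp only [Matrix.mulVec, dotProduct, mul_sub, Finset.sum_sub_distrib]

theorem screenedLaplacian_mulVec (W : Matrix ι ι ℝ) (d u : ι → ℝ) (i : ι) :
    (screenedLaplacian W d *ᵥ u) i = d i * u i + ∑ j, W i j * (u i - u j) := by
  rw [screenedLaplacian, Matrix.add_mulVec, Pi.add_apply, Matrix.mulVec_diagonal,
    weightedLaplacian_mulVec]

variable {W : Matrix ι ι ℝ}

theorem dotProduct_weightedLaplacian_mulVec (hW : W.IsSymm) (u : ι → ℝ) :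
    u ⬝ᵥ weightedLaplacian W *ᵥ u = (∑ i, ∑ j, W i j * (u i - u j) ^ 2) / 2 := by
  have hswap : ∑ i, ∑ j, u i * (W i j * (u i - u j)) = ∑ i, ∑ j, u j * (W i j * (u j - u i)) := by
    rw [Finset.sum_comm]
    simp only [hW.apply]
  have hexpand : u ⬝ᵥ weightedLaplacian W *ᵥ u = ∑ i, ∑ j, u i * (W i j * (u i - u j)) := by
    simp only [dotProduct, weightedLaplacian_mulVec, Finset.mul_sum]
  rw [hexpand, eq_div_iff two_ne_zero, mul_two]
  nth_rewrite 2 [hswap]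
  simp only [← Finset.sum_add_distrib]
  refine Finset.sum_congr rfl fun i _ => Finset.sum_congr rfl fun j _ => ?_
  ring

theorem weightedLaplacian_posSemidef (hW : W.IsSymm) (hW0 : ∀ i j, 0 ≤ W i j) :
    (weightedLaplacian W).PosSemidef := by
  refine .of_dotProduct_mulVec_nonneg ?_ fun u => ?_
  · exact (Matrix.isHermitian_diagonal _).sub ((W.conjTranspose_eq_transpose_of_trivial).trans hW)
  · rw [star_trivial, dotProduct_weightedLaplacian_mulVec hW]
    exact div_nonneg (Finset.sum_nonneg fun i _ => Finset.sum_nonneg fun j _ =>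
      mul_nonneg (hW0 i j) (sq_nonneg _)) zero_le_two

variable {d : ι → ℝ}

theorem screenedLaplacian_posDef (hW : W.IsSymm) (hW0 : ∀ i j, 0 ≤ W i j) (hd : ∀ i, 0 < d i) :
    (screenedLaplacian W d).PosDef :=
  (Matrix.PosDef.diagonal hd).add_posSemidef (weightedLaplacian_posSemidef hW hW0)

theorem nonneg_of_screenedLaplacian_mulVec_nonneg (hW0 : ∀ i j, 0 ≤ W i j) (hd : ∀ i, 0 < d i)
    {u : ι → ℝ} (hu : 0 ≤ screenedLaplacian W d *ᵥ u) : 0 ≤ u := by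
  intro i
  obtain ⟨w, -, hmin⟩ := Finset.exists_min_image Finset.univ u ⟨i, Finset.mem_univ i⟩
  have hdiff : ∑ j, W w j * (u w - u j) ≤ 0 := Finset.sum_nonpos fun j hj =>
    mul_nonpos_of_nonneg_of_nonpos (hW0 w j) (sub_nonpos.2 (hmin j hj))
  have hw : 0 ≤ d w * u w := by
    have := hu w
    rw [screenedLaplacian_mulVec, Pi.zero_apply] at this
    linarith
  exact (nonneg_of_mul_nonneg_right hw (hd w)).trans (hmin i (Finset.mem_univ i))

theorem le_of_screenedLaplacian_mulVec_nonpos (hW0 : ∀ i j, 0 ≤ W i j) (hd : ∀ i, 0 < d i)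
    {u : ι → ℝ} {i : ι} (hi : 0 ≤ u i) (hu : ∀ v ≠ i, (screenedLaplacian W d *ᵥ u) v ≤ 0) (v : ι) :
    u v ≤ u i := by
  obtain ⟨w, -, hmax⟩ := Finset.exists_max_image Finset.univ u ⟨i, Finset.mem_univ i⟩
  refine (hmax v (Finset.mem_univ v)).trans ?_
  by_cases hwi : w = i
  · rw [hwi]
  have hdiff : 0 ≤ ∑ j, W w j * (u w - u j) := Finset.sum_nonneg fun j hj =>
    mul_nonneg (hW0 w j) (sub_nonneg.2 (hmax j hj))
  have hw : d w * u w ≤ 0 := by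
    have := hu w hwi
    rw [screenedLaplacian_mulVec] at this
    linarith
  exact (nonpos_of_mul_nonpos_right hw (hd w)).trans hi

section Inverse

variable (hW : W.IsSymm) (hW0 : ∀ i j, 0 ≤ W i j) (hd : ∀ i, 0 < d i)
include hW hW0 hd

theorem isUnit_det_screenedLaplacian : IsUnit (screenedLaplacian W d).det :=
  (Matrix.isUnit_iff_isUnit_det _).1 (screenedLaplacian_posDef hW hW0 hd).isUnit

theorem screenedLaplacian_mulVec_inv_col (j : ι) :
    screenedLaplacian W d *ᵥ (screenedLaplacian W d)⁻¹.col j = Pi.single j 1 := by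
  rw [← Matrix.mulVec_single_one, Matrix.mulVec_mulVec,
    Matrix.mul_nonsing_inv _ (isUnit_det_screenedLaplacian hW hW0 hd), Matrix.one_mulVec]

theorem screenedLaplacian_inv_apply_nonneg (i j : ι) : 0 ≤ (screenedLaplacian W d)⁻¹ i j := by
  refine nonneg_of_screenedLaplacian_mulVec_nonneg hW0 hd
    (u := (screenedLaplacian W d)⁻¹.col j) ?_ i
  rw [screenedLaplacian_mulVec_inv_col hW hW0 hd]
  exact Pi.single_nonneg.2 zero_le_one

theorem screenedLaplacian_inv_apply_le_diag (i j : ι) :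
    (screenedLaplacian W d)⁻¹ i j ≤ (screenedLaplacian W d)⁻¹ i i := by
  have hcol : (screenedLaplacian W d)⁻¹ j i ≤ (screenedLaplacian W d)⁻¹ i i := by
    refine le_of_screenedLaplacian_mulVec_nonpos hW0 hd (u := (screenedLaplacian W d)⁻¹.col i)
      (screenedLaplacian_inv_apply_nonneg hW hW0 hd i i) (fun v hv => ?_) j
    rw [screenedLaplacian_mulVec_inv_col hW hW0 hd, Pi.single_eq_of_ne hv]
  rwa [← (screenedLaplacian_posDef hW hW0 hd).isHermitian.inv.apply, star_trivial] at hcol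

theorem screenedLaplacian_inv_mulVec_self : (screenedLaplacian W d)⁻¹ *ᵥ d = 1 := by
  have hone : screenedLaplacian W d *ᵥ 1 = d := by
    ext i
    simp [screenedLaplacian_mulVec]
  nth_rewrite 2 [← hone]
  rw [Matrix.mulVec_mulVec, Matrix.nonsing_inv_mul _ (isUnit_det_screenedLaplacian hW hW0 hd),
    Matrix.one_mulVec]

end Inverse

end Laplacian

section McDiarmid

theorem hasSubgaussianMGF_sub_integral_of_sub_le {Ω : Type*} [MeasurableSpace Ω] {μ : Measure Ω}
    [IsProbabilityMeasure μ] {X : Ω → ℝ} (hX : AEMeasurable X μ) {c : ℝ≥0}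
    (hc : ∀ ω ω', X ω - X ω' ≤ c) :
    HasSubgaussianMGF (fun ω => X ω - ∫ ω', X ω' ∂μ) ((c / 2) ^ 2) μ := by
  have := nonempty_of_isProbabilityMeasure μ
  have hbdd : BddBelow (Set.range X) :=
    ⟨X (Classical.arbitrary Ω) - c, by rintro _ ⟨ω, rfl⟩; linarith [hc (Classical.arbitrary Ω) ω]⟩
  have hmem (ω : Ω) : X ω ∈ Set.Icc (⨅ ω', X ω') ((⨅ ω', X ω') + c) :=
    ⟨ciInf_le hbdd ω, sub_le_iff_le_add.1 (le_ciInf fun ω' => by linarith [hc ω ω'])⟩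
  simpa using hasSubgaussianMGF_of_mem_Icc hX (.of_forall hmem)

theorem hasSubgaussianMGF_prod {α β : Type*} [MeasurableSpace α] [MeasurableSpace β]
    {ν : Measure α} {π : Measure β} [SFinite ν] [IsProbabilityMeasure π]
    {f : α × β → ℝ} {F : α → ℝ} {c c' : ℝ≥0}
    (hf : ∀ t : ℝ, Integrable (fun z => Real.exp (t * f z)) (ν.prod π))
    (hF : HasSubgaussianMGF F c ν)
    (hfF : ∀ a, HasSubgaussianMGF (fun b => f (a, b) - F a) c' π) :
    HasSubgaussianMGF f (c + c') (ν.prod π) where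
  integrable_exp_mul := hf
  mgf_le t := by
    have hsection (a : α) : ∫ b, Real.exp (t * f (a, b)) ∂π ≤
        Real.exp (t * F a) * Real.exp (c' * t ^ 2 / 2) := by
      calc ∫ b, Real.exp (t * f (a, b)) ∂π
          = Real.exp (t * F a) * mgf (fun b => f (a, b) - F a) π t := by
            rw [mgf, ← integral_const_mul]
            congr with b
            rw [← Real.exp_add]
            ring_nf
        _ ≤ Real.exp (t * F a) * Real.exp (c' * t ^ 2 / 2) := by
            gcongr
            exact (hfF a).mgf_le t
    calc mgf f (ν.prod π) t
        = ∫ a, ∫ b, Real.exp (t * f (a, b)) ∂π ∂ν := integral_prod _ (hf t)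
      _ ≤ ∫ a, Real.exp (t * F a) * Real.exp (c' * t ^ 2 / 2) ∂ν :=
          integral_mono (hf t).integral_prod_left ((hF.integrable_exp_mul t).mul_const _) hsection
      _ = mgf F ν t * Real.exp (c' * t ^ 2 / 2) := integral_mul_const _ _
      _ ≤ Real.exp (c * t ^ 2 / 2) * Real.exp (c' * t ^ 2 / 2) := by
          gcongr
          exact hF.mgf_le t
      _ = Real.exp ((c + c' : ℝ≥0) * t ^ 2 / 2) := by
          rw [← Real.exp_add]
          push_cast
          ring_nf

/-- Changing the coordinate `k` of its argument increases `f` by at most `c k`. Exchanging the two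
arguments shows that it decreases `f` by at most as much. -/
def HasBoundedDifferences {ι : Type*} {α : ι → Type*} (f : (∀ k, α k) → ℝ) (c : ι → ℝ≥0) : Prop :=
  ∀ k x x', (∀ j, j ≠ k → x j = x' j) → f x - f x' ≤ c k

namespace HasBoundedDifferences

section Fintype

variable {ι : Type*} {α : ι → Type*} {f : (∀ k, α k) → ℝ} {c : ι → ℝ≥0}

theorem sub_const (hf : HasBoundedDifferences f c) (r : ℝ) :
    HasBoundedDifferences (fun x => f x - r) c :=
  fun k x x' h => by
    rw [sub_sub_sub_cancel_right]
    exact hf k x x' h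

variable [Fintype ι]

theorem sub_le_sum (hf : HasBoundedDifferences f c) (x x' : ∀ k, α k) :
    f x - f x' ≤ ∑ k, c k := by
  classical
  suffices h : ∀ s : Finset ι, f (s.piecewise x x') - f x' ≤ ∑ k ∈ s, c k by
    simpa using h Finset.univ
  intro s
  induction s using Finset.induction_on with
  | empty => simp
  | insert k s hk ih =>
    have hchange := hf k ((insert k s).piecewise x x') (s.piecewise x x') fun j hj => by
      rw [Finset.piecewise_insert, Function.update_of_ne hj]
    rw [Finset.sum_insert hk]
    push_cast at ih ⊢
    linarith

theorem mem_Icc (hf : HasBoundedDifferences f c) (x x' : ∀ k, α k) :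
    f x ∈ Set.Icc (f x' - ∑ k, c k) (f x' + ∑ k, c k) :=
  ⟨by linarith [hf.sub_le_sum x' x], by linarith [hf.sub_le_sum x x']⟩

end Fintype

section Finite

variable {ι : Type*} [Finite ι] {α : ι → Type*} [∀ k, MeasurableSpace (α k)]
  {f : (∀ k, α k) → ℝ} {c : ι → ℝ≥0} {μ : Measure (∀ k, α k)} [IsProbabilityMeasure μ]

theorem integrable (hf : HasBoundedDifferences f c) (hm : Measurable f) : Integrable f μ :=
  have := Fintype.ofFinite ι
  have := nonempty_of_isProbabilityMeasure μ
  .of_mem_Icc _ _ hm.aemeasurable (.of_forall fun x => hf.mem_Icc x (Classical.arbitrary _))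

theorem integrable_exp_mul (hf : HasBoundedDifferences f c) (hm : Measurable f) (t : ℝ) :
    Integrable (fun x => Real.exp (t * f x)) μ :=
  have := Fintype.ofFinite ι
  have := nonempty_of_isProbabilityMeasure μ
  integrable_exp_mul_of_mem_Icc hm.aemeasurable
    (.of_forall fun x => hf.mem_Icc x (Classical.arbitrary _))

end Finite

section Fin

variable {N : ℕ} {α : Fin (N + 1) → Type*} {f : (∀ k, α k) → ℝ} {c : Fin (N + 1) → ℝ≥0}

theorem comp_cons (hf : HasBoundedDifferences f c) (a : α 0) :
    HasBoundedDifferences (fun x => f (Fin.cons a x)) fun k => c k.succ :=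
  fun k x x' h => hf k.succ _ _ fun j hj => by
    cases j using Fin.cases with
    | zero => rfl
    | succ j => simpa using h j fun hjk => hj (hjk ▸ rfl)

variable [∀ k, MeasurableSpace (α k)]

theorem measurable_cons :
    Measurable fun z : α 0 × (∀ k : Fin N, α k.succ) => (Fin.cons z.1 z.2 : ∀ k, α k) :=
  measurable_pi_lambda _ fun k => by
    cases k using Fin.cases with
    | zero => exact measurable_fst
    | succ k => exact (measurable_pi_apply k).comp measurable_snd

theorem measurePreserving_cons (ν : ∀ k, Measure (α k)) [∀ k, SigmaFinite (ν k)] :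
    MeasurePreserving (fun z : α 0 × (∀ k : Fin N, α k.succ) => (Fin.cons z.1 z.2 : ∀ k, α k))
      ((ν 0).prod (Measure.pi fun k => ν (Fin.succ k))) (Measure.pi ν) := by
  refine ⟨measurable_cons, (Measure.pi_eq fun s hs => ?_).symm⟩
  have hrect : (fun z : α 0 × (∀ k : Fin N, α k.succ) => (Fin.cons z.1 z.2 : ∀ k, α k)) ⁻¹'
      Set.univ.pi s = s 0 ×ˢ Set.univ.pi fun k : Fin N => s k.succ := by
    ext z
    simp [Set.mem_pi, Fin.forall_fin_succ]
  rw [Measure.map_apply measurable_cons (.univ_pi hs), hrect, Measure.prod_prod, Measure.pi_pi,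
    Fin.prod_univ_succ]

theorem integral_cons_sub_le (hf : HasBoundedDifferences f c) (hm : Measurable f)
    (π : Measure (∀ k : Fin N, α k.succ)) [IsProbabilityMeasure π] (a a' : α 0) :
    (∫ x, f (Fin.cons a x) ∂π) - ∫ x, f (Fin.cons a' x) ∂π ≤ c 0 := by
  have hint (b : α 0) : Integrable (fun x => f (Fin.cons b x)) π :=
    (hf.comp_cons b).integrable (hm.comp (measurable_cons.comp measurable_prodMk_left))
  rw [← integral_sub (hint a) (hint a')]
  calc ∫ x, (f (Fin.cons a x) - f (Fin.cons a' x)) ∂π ≤ ∫ _, (c 0 : ℝ) ∂π :=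
        integral_mono ((hint a).sub (hint a')) (integrable_const _) fun x =>
          hf 0 _ _ fun j hj => by
            cases j using Fin.cases with
            | zero => exact absurd rfl hj
            | succ j => rfl
    _ = c 0 := by simp

end Fin

/-- McDiarmid's inequality, from which the tail bound follows by Chernoff. -/
theorem hasSubgaussianMGF {N : ℕ} {α : Fin N → Type*} [∀ k, MeasurableSpace (α k)]
    {f : (∀ k, α k) → ℝ} {c : Fin N → ℝ≥0} (hf : HasBoundedDifferences f c) (hm : Measurable f)
    (ν : ∀ k, Measure (α k)) [∀ k, IsProbabilityMeasure (ν k)] :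
    HasSubgaussianMGF (fun x => f x - ∫ x', f x' ∂Measure.pi ν) (∑ k, (c k / 2) ^ 2)
      (Measure.pi ν) := by
  induction N with
  | zero =>
    have hconst (x : ∀ k, α k) : f x - ∫ x', f x' ∂Measure.pi ν = 0 := by
      have := integral_congr_ae (μ := Measure.pi ν)
        (.of_forall fun x' => congrArg f (Subsingleton.elim x' x))
      simp [this]
    simp [hconst]
  | succ N ih =>
    let π := Measure.pi fun k => ν (Fin.succ k)
    have hcons := measurePreserving_cons ν
    let F (a : α 0) : ℝ := ∫ x, f (Fin.cons a x) ∂π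
    let g (z : α 0 × ∀ k : Fin N, α k.succ) : ℝ := f (Fin.cons z.1 z.2) - ∫ x, f x ∂Measure.pi ν
    have hmg : Measurable fun z : α 0 × (∀ k : Fin N, α k.succ) => f (Fin.cons z.1 z.2) :=
      hm.comp hcons.measurable
    have hmean : ∫ x, f x ∂Measure.pi ν = ∫ a, F a ∂ν 0 := by
      rw [← hcons.map_eq, integral_map hcons.measurable.aemeasurable hm.aestronglyMeasurable]
      exact integral_prod _ (hcons.integrable_comp_of_integrable (hf.integrable hm))
    have hF : HasSubgaussianMGF (fun a => F a - ∫ x, f x ∂Measure.pi ν) ((c 0 / 2) ^ 2) (ν 0) := by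
      rw [hmean]
      exact hasSubgaussianMGF_sub_integral_of_sub_le
        hmg.stronglyMeasurable.integral_prod_right.measurable.aemeasurable
        (hf.integral_cons_sub_le hm π)
    have hsection (a : α 0) :
        HasSubgaussianMGF (fun x => g (a, x) - (F a - ∫ x, f x ∂Measure.pi ν))
          (∑ k : Fin N, (c k.succ / 2) ^ 2) π := by
      simp only [g, sub_sub_sub_cancel_right]
      exact ih (hf.comp_cons a) (hmg.comp measurable_prodMk_left) fun k => ν k.succ
    have hexp (t : ℝ) : Integrable (fun z => Real.exp (t * g z)) ((ν 0).prod π) :=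
      hcons.integrable_comp_of_integrable ((hf.sub_const _).integrable_exp_mul (hm.sub_const _) t)
    have hg := hasSubgaussianMGF_prod hexp hF hsection
    rw [← Fin.sum_univ_succ fun k => (c k / 2) ^ 2] at hg
    exact hg.congr_identDistrib ⟨(hmg.sub_const _).aemeasurable, (hm.sub_const _).aemeasurable,
      (Measure.map_map (hm.sub_const _) hcons.measurable).symm.trans (by rw [hcons.map_eq])⟩

end HasBoundedDifferences

end McDiarmid

section UniformStability

theorem measurePreserving_update {ι : Type*} [Fintype ι] [DecidableEq ι] {α : ι → Type*}
    [∀ k, MeasurableSpace (α k)] (ν : ∀ k, Measure (α k)) [∀ k, IsProbabilityMeasure (ν k)]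
    (k : ι) :
    MeasurePreserving (fun z : (∀ j, α j) × α k => Function.update z.1 k z.2)
      ((Measure.pi ν).prod (ν k)) (Measure.pi ν) := by
  have hmeas : Measurable fun z : (∀ j, α j) × α k => Function.update z.1 k z.2 :=
    measurable_update'
  refine ⟨hmeas, (Measure.pi_eq fun s hs => ?_).symm⟩
  have hrect : (fun z : (∀ j, α j) × α k => Function.update z.1 k z.2) ⁻¹' Set.univ.pi s =
      Set.univ.pi (Function.update s k Set.univ) ×ˢ s k := by
    ext z
    simp only [Set.mem_preimage, Set.mem_univ_pi, Set.mem_prod]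
    rw [← and_forall_ne k, Function.update_self, and_comm,
      ← and_forall_ne (p := fun j => z.1 j ∈ _) k, Function.update_self]
    simp +contextual [Function.update_of_ne]
  have hprod : ∏ j, ν j (Function.update s k Set.univ j) =
      ∏ j ∈ Finset.univ.erase k, ν j (s j) := by
    rw [← Finset.mul_prod_erase _ _ (Finset.mem_univ k), Function.update_self, measure_univ,
      one_mul]
    exact Finset.prod_congr rfl fun j hj => by
      rw [Function.update_of_ne (Finset.ne_of_mem_erase hj)]
  rw [Measure.map_apply hmeas (.univ_pi hs), hrect, Measure.prod_prod, Measure.pi_pi, hprod,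
    Finset.prod_erase_mul _ _ (Finset.mem_univ k)]

/-- The loss `A S z` at `z` of the predictor learned from the sample `S` changes by at most `β` if
one example of `S` is replaced. -/
def UniformlyStable {ι α : Type*} (A : (ι → α) → α → ℝ) (β : ℝ≥0) : Prop :=
  ∀ S S' : ι → α, (∃ k, ∀ j, j ≠ k → S j = S' j) → ∀ z, |A S z - A S' z| ≤ β

/-- The true risk minus the empirical risk of the predictor learned from the sample `S`, whose loss
at `z` is `A S z`. -/
noncomputable def generalizationGap {ι α : Type*} [Fintype ι] [MeasurableSpace α]
    (A : (ι → α) → α → ℝ) (ν : Measure α) (S : ι → α) : ℝ :=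
  (∫ z, A S z ∂ν) - (1 / (Fintype.card ι : ℝ)) * ∑ k, A S (S k)

variable {ι α : Type*} [MeasurableSpace α] {A : (ι → α) → α → ℝ} {β M : ℝ≥0} {ν : Measure α}

theorem measurable_apply_self (hA : Measurable (Function.uncurry A)) (k : ι) :
    Measurable fun S : ι → α => A S (S k) :=
  hA.comp (measurable_id.prodMk (measurable_pi_apply k))

variable [Fintype ι]

theorem measurable_generalizationGap [SFinite ν] (hA : Measurable (Function.uncurry A)) :
    Measurable (generalizationGap A ν) :=
  hA.stronglyMeasurable.integral_prod_right.measurable.sub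
    ((Finset.univ.measurable_fun_sum fun k _ => measurable_apply_self hA k).const_mul _)

variable [IsProbabilityMeasure ν]

/-- Exchanging the example `S k` with a fresh one preserves the law of the pair, so the loss at
`S k` is, in the mean, the loss at a fresh point of the predictor learned from a changed sample. -/
theorem integral_sub_le_of_uniformlyStable (hstable : UniformlyStable A β)
    (hA : Measurable (Function.uncurry A)) (hmem : ∀ S z, A S z ∈ Set.Icc 0 (M : ℝ)) (k : ι) :
    ∫ S, ((∫ z, A S z ∂ν) - A S (S k)) ∂Measure.pi (fun _ => ν) ≤ β := by
  classical
  let π := Measure.pi fun _ : ι => ν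
  have hupdate := measurePreserving_update (fun _ : ι => ν) k
  have hdiag := measurable_apply_self hA k
  have hint : Integrable (fun x : (ι → α) × α => A x.1 x.2) (π.prod ν) :=
    .of_mem_Icc _ _ hA.aemeasurable (.of_forall fun _ => hmem _ _)
  have hintdiag : Integrable (fun S : ι → α => A S (S k)) π :=
    .of_mem_Icc _ _ hdiag.aemeasurable (.of_forall fun _ => hmem _ _)
  have hintupdate : Integrable (fun x : (ι → α) × α => A (Function.update x.1 k x.2) x.2)
      (π.prod ν) := by
    simpa [Function.comp_def] using hupdate.integrable_comp_of_integrable hintdiag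
  have hresample : ∫ S, A S (S k) ∂π =
      ∫ x : (ι → α) × α, A (Function.update x.1 k x.2) x.2 ∂π.prod ν := by
    calc ∫ S, A S (S k) ∂π
        = ∫ S, A S (S k) ∂(π.prod ν).map fun z => Function.update z.1 k z.2 := by
          rw [hupdate.map_eq]
      _ = ∫ x : (ι → α) × α, A (Function.update x.1 k x.2) x.2 ∂π.prod ν := by
          rw [integral_map hupdate.measurable.aemeasurable hdiag.aestronglyMeasurable]
          simp only [Function.update_self]
  calc ∫ S, ((∫ z, A S z ∂ν) - A S (S k)) ∂π
      = ∫ x : (ι → α) × α, (A x.1 x.2 - A (Function.update x.1 k x.2) x.2) ∂π.prod ν := by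
        rw [integral_sub hint.integral_prod_left hintdiag, hresample, ← integral_prod _ hint,
          ← integral_sub hint hintupdate]
    _ ≤ ∫ _, (β : ℝ) ∂π.prod ν :=
        integral_mono (hint.sub hintupdate) (integrable_const _) fun x =>
          (le_abs_self _).trans (hstable _ _ ⟨k, fun j hj => by simp [hj]⟩ _)
    _ = β := by simp

theorem integral_generalizationGap_le [Nonempty ι] (hstable : UniformlyStable A β)
    (hA : Measurable (Function.uncurry A)) (hmem : ∀ S z, A S z ∈ Set.Icc 0 (M : ℝ)) :
    ∫ S, generalizationGap A ν S ∂Measure.pi (fun _ => ν) ≤ β := by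
  have hgap (S : ι → α) : generalizationGap A ν S =
      (1 / (Fintype.card ι : ℝ)) * ∑ k, ((∫ z, A S z ∂ν) - A S (S k)) := by
    rw [generalizationGap, Finset.sum_sub_distrib, mul_sub]
    simp
  have hintrisk : Integrable (fun S => ∫ z, A S z ∂ν) (Measure.pi fun _ : ι => ν) :=
    Integrable.integral_prod_left (f := Function.uncurry A)
      (.of_mem_Icc _ _ hA.aemeasurable (.of_forall fun _ => hmem _ _))
  have hintk (k : ι) : Integrable (fun S => (∫ z, A S z ∂ν) - A S (S k))
      (Measure.pi fun _ => ν) :=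
    hintrisk.sub
      (.of_mem_Icc _ _ (measurable_apply_self hA k).aemeasurable (.of_forall fun _ => hmem _ _))
  simp only [hgap]
  rw [integral_const_mul, integral_finsetSum _ fun k _ => hintk k, one_div_mul_eq_div,
    div_le_iff₀ (by positivity)]
  calc ∑ k, ∫ S, ((∫ z, A S z ∂ν) - A S (S k)) ∂Measure.pi (fun _ => ν) ≤ ∑ _ : ι, (β : ℝ) :=
        Finset.sum_le_sum fun k _ => integral_sub_le_of_uniformlyStable hstable hA hmem k
    _ = β * Fintype.card ι := by simp [mul_comm]

theorem hasBoundedDifferences_generalizationGap [Nonempty ι] (hstable : UniformlyStable A β)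
    (hA : Measurable (Function.uncurry A)) (hmem : ∀ S z, A S z ∈ Set.Icc 0 (M : ℝ)) :
    HasBoundedDifferences (generalizationGap A ν) fun _ : ι => 2 * β + M / Fintype.card ι := by
  classical
  intro k S S' h
  have hint (S : ι → α) : Integrable (A S) ν :=
    .of_mem_Icc _ _ (hA.comp measurable_prodMk_left).aemeasurable (.of_forall (hmem S))
  have hrisk : (∫ z, A S z ∂ν) - ∫ z, A S' z ∂ν ≤ β := by
    rw [← integral_sub (hint S) (hint S')]
    calc ∫ z, (A S z - A S' z) ∂ν ≤ ∫ _, (β : ℝ) ∂ν :=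
          integral_mono ((hint S).sub (hint S')) (integrable_const _) fun z =>
            (le_abs_self _).trans (hstable _ _ ⟨k, h⟩ z)
      _ = β := by simp
  have hterm (j : ι) : A S' (S' j) - A S (S j) ≤ β + if j = k then (M : ℝ) else 0 := by
    split_ifs with hj
    · linarith [(hmem S' (S' j)).2, (hmem S (S j)).1, β.coe_nonneg]
    · rw [h j hj, add_zero]
      exact (le_abs_self _).trans (hstable _ _ ⟨k, fun i hi => (h i hi).symm⟩ _)
  have hempirical : (1 / (Fintype.card ι : ℝ)) * (∑ j, A S' (S' j) - ∑ j, A S (S j)) ≤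
      β + M / Fintype.card ι := by
    rw [← Finset.sum_sub_distrib, one_div_mul_eq_div, div_le_iff₀ (by positivity)]
    calc ∑ j, (A S' (S' j) - A S (S j)) ≤ ∑ j, (β + if j = k then (M : ℝ) else 0) :=
          Finset.sum_le_sum fun j _ => hterm j
      _ = Fintype.card ι * β + M := by
          rw [Finset.sum_add_distrib, Fintype.sum_ite_eq', Finset.sum_const, Finset.card_univ,
            nsmul_eq_mul]
      _ = (β + M / Fintype.card ι) * Fintype.card ι := by field_simp
  push_cast
  rw [generalizationGap, generalizationGap]
  linarith

theorem measureReal_generalizationGap_ge_le {N : ℕ} [NeZero N] {A : (Fin N → α) → α → ℝ}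
    (hstable : UniformlyStable A β) (hA : Measurable (Function.uncurry A))
    (hmem : ∀ S z, A S z ∈ Set.Icc 0 (M : ℝ)) (hM : 0 < M) {r : ℝ} (hr : 0 ≤ r) :
    (Measure.pi fun _ => ν).real
        {S | β + (2 * β + M / N) * √(N * r / 2) ≤ generalizationGap A ν S} ≤ Real.exp (-r) := by
  have hN : (0 : ℝ) < N := Nat.cast_pos.2 (NeZero.pos N)
  have hmeas : Measurable (generalizationGap A ν) := measurable_generalizationGap hA
  have hsub := (hasBoundedDifferences_generalizationGap (ν := ν) hstable hA hmem).hasSubgaussianMGF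
    hmeas fun _ => ν
  have hC : 0 < 2 * (β : ℝ) + M / N := by positivity
  calc _ ≤ (Measure.pi fun _ => ν).real {S | (2 * β + M / N) * √(N * r / 2) ≤
        generalizationGap A ν S - ∫ S', generalizationGap A ν S' ∂Measure.pi fun _ => ν} :=
        measureReal_mono fun S hS => by
          have := integral_generalizationGap_le (ν := ν) hstable hA hmem
          simp only [Set.mem_ofPred_eq] at hS ⊢
          linarith
    _ ≤ _ := hsub.measure_ge_le (mul_nonneg hC.le (Real.sqrt_nonneg _))
    _ = Real.exp (-r) := by
        congr 1
        rw [mul_pow, Real.sq_sqrt (by positivity)]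
        simp only [Finset.sum_const, Finset.card_univ, Fintype.card_fin, nsmul_eq_mul]
        push_cast
        field_simp

end UniformStability

theorem card_image_sdiff_image_le_one {ι α : Type*} [Fintype ι] [DecidableEq α] {S S' : ι → α}
    {k : ι} (h : ∀ j, j ≠ k → S j = S' j) :
    (Finset.univ.image S' \ Finset.univ.image S).card ≤ 1 := by
  suffices hsub : Finset.univ.image S' \ Finset.univ.image S ⊆ {S' k} from
    Finset.card_le_card hsub
  intro v hv
  obtain ⟨hv', hv⟩ := Finset.mem_sdiff.1 hv
  obtain ⟨j, -, rfl⟩ := Finset.mem_image.1 hv'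
  by_cases hjk : j = k
  · rw [hjk, Finset.mem_singleton]
  · exact absurd (Finset.mem_image.2 ⟨j, Finset.mem_univ j, h j hjk⟩) hv

theorem one_sub_sq_sub_one_sub_sq_le {x x' X z q m ε : ℝ} (hxX : x ≤ X) (hX : X ≤ 1)
    (hzx' : z ≤ x') (hx' : x' ≤ 1) (hqm : q ≤ m) (hm : m ≤ 1) (hq : 0 ≤ q) (hε : 0 ≤ ε)
    (hdiff : X - z ≤ (1 + ε) * q) (hsum : 2 * q - 2 * m ≤ X + z) :
    (1 - x') ^ 2 - (1 - x) ^ 2 ≤ 2 * (1 + ε) * m := by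
  have h1 : (1 - x') ^ 2 ≤ (1 - z) ^ 2 := pow_le_pow_left₀ (by linarith) (by linarith) 2
  have h2 : (1 - X) ^ 2 ≤ (1 - x) ^ 2 := pow_le_pow_left₀ (by linarith) (by linarith) 2
  -- `(1 - z) ^ 2 - (1 - X) ^ 2 = (X - z) * (2 - (X + z))`
  have hprod : (X - z) * (2 - (X + z)) ≤ (1 + ε) * q * (2 - (2 * q - 2 * m)) :=
    mul_le_mul hdiff (by linarith) (by linarith) (by positivity)
  have hmq : 0 ≤ (1 + ε) * ((m - q) * (1 - q)) :=
    mul_nonneg (by linarith) (mul_nonneg (by linarith) (by linarith))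
  linarith

theorem two_sub_sq_le_sqrt_two_div {x : ℝ} (hx0 : 0 < x) (hx1 : x ≤ 1) :
    2 - x ^ 2 ≤ √2 / x := by
  rw [le_div_iff₀ hx0]
  refine Real.le_sqrt_of_sq_le ?_
  nlinarith [mul_nonneg (sq_nonneg (3 * x ^ 2 - 2))
    (sub_nonneg.2 (pow_le_one₀ hx0.le hx1 : x ^ 2 ≤ 1))]

section Rate

variable {N κ x : ℝ}

theorem mul_sqrt_eq_rpow (hN : 0 ≤ N) : N * √N = N ^ (3 / 2 : ℝ) := by
  rw [Real.sqrt_eq_rpow, ← Real.rpow_one_add' hN (by norm_num)]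
  norm_num

theorem mul_le_of_mul_rpow_le (hκ : 0 ≤ κ) (hN : 1 ≤ N) (h : κ * N ^ (3 / 2 : ℝ) ≤ x) :
    κ * N ≤ x := by
  refine le_trans (mul_le_mul_of_nonneg_left ?_ hκ) h
  exact Real.self_le_rpow_of_one_le hN (by norm_num)

theorem sqrt_div_le_of_mul_rpow_le (hκ : 0 < κ) (hN : 0 < N) (h : κ * N ^ (3 / 2 : ℝ) ≤ x) :
    √N / x ≤ 1 / (κ * N) := by
  have hx : 0 < x := (mul_pos hκ (Real.rpow_pos_of_pos hN _)).trans_le h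
  rw [← mul_sqrt_eq_rpow hN.le] at h
  rw [div_le_div_iff₀ hx (mul_pos hκ hN)]
  linarith

end Rate

theorem transductiveError_mono {β β' : ℝ} (h : β ≤ β') (nl : ℕ) (δ : ℝ) :
    transductiveError β nl δ ≤ transductiveError β' nl δ := by
  unfold transductiveError
  gcongr

theorem mcdiarmid_threshold_le_transductiveError (β : ℝ) {nl : ℕ} (hnl : 0 < nl) {δ : ℝ} :
    β + (2 * β + 4 / nl) * √(nl * Real.log (2 / δ) / 2) ≤ transductiveError β nl δ := by
  have : (0 : ℝ) < nl := Nat.cast_pos.2 hnl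
  have hsqrt : √(nl * Real.log (2 / δ) / 2) = nl / 2 * √(2 * Real.log (2 / δ) / nl) := by
    rw [← Real.sqrt_sq (by positivity : (0 : ℝ) ≤ nl / 2), ← Real.sqrt_mul (by positivity)]
    congr 1
    field_simp
  have hmul : (2 * β + 4 / nl) * (nl / 2 * √(2 * Real.log (2 / δ) / nl)) =
      √(2 * Real.log (2 / δ) / nl) * (nl * β + 2) := by
    field_simp
    ring
  rw [transductiveError, hsqrt, hmul]
  gcongr
  norm_num

theorem four_le_transductiveError {β : ℝ} (hβ : 1 ≤ β) {nl : ℕ} (hnl : 0 < nl) {δ : ℝ}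
    (hδ0 : 0 < δ) (hδ1 : δ < 1) : 4 ≤ transductiveError β nl δ := by
  have hnl' : (0 : ℝ) < nl := Nat.cast_pos.2 hnl
  have hlog : 1 / 2 ≤ Real.log (2 / δ) := by
    have hmono : Real.log 2 ≤ Real.log (2 / δ) :=
      Real.log_le_log two_pos (by rw [le_div_iff₀ hδ0]; linarith)
    linarith [Real.log_two_gt_d9]
  have hroot : √(1 / (nl : ℝ)) ≤ √(2 * Real.log (2 / δ) / nl) :=
    Real.sqrt_le_sqrt (by gcongr; linarith)
  have hscale : √(1 / (nl : ℝ)) * (nl + 4) ≤ √(2 * Real.log (2 / δ) / nl) * (nl * β + 4) := by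
    refine mul_le_mul hroot ?_ (by positivity) (Real.sqrt_nonneg _)
    nlinarith
  -- AM-GM: `4 √nl ≤ nl + 4`
  have hfour : 4 ≤ √(1 / (nl : ℝ)) * (nl + 4) := by
    have hpos : 0 < √(nl : ℝ) := Real.sqrt_pos.2 hnl'
    have hsq := Real.sq_sqrt hnl'.le
    rw [Real.sqrt_div zero_le_one, Real.sqrt_one, div_mul_eq_mul_div, one_mul, le_div_iff₀ hpos]
    nlinarith [sq_nonneg (√(nl : ℝ) - 2)]
  rw [transductiveError]
  linarith

theorem integral_eq_mul_sum_of_measureReal_singleton {α : Type*} [Fintype α] [MeasurableSpace α]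
    [MeasurableSingletonClass α] {ν : Measure α} [IsFiniteMeasure ν] {r : ℝ}
    (hν : ∀ a, ν.real {a} = r) (f : α → ℝ) : ∫ a, f a ∂ν = r * ∑ a, f a := by
  simp only [integral_fintype .of_finite, hν, smul_eq_mul, Finset.mul_sum]

theorem exists_map_eq_pi_of_iIndepFun {ι Ω α : Type*} [Fintype ι] [MeasurableSpace Ω]
    [MeasurableSpace α] [Countable α] [MeasurableSingletonClass α] {μ : Measure Ω}
    [IsProbabilityMeasure μ] {s : ι → Ω → α} (hs : ∀ k, Measurable (s k)) (hind : iIndepFun s μ)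
    {q : α → ℝ} (hq : ∀ k a, μ.real (s k ⁻¹' {a}) = q a) (k₀ : ι) :
    ∃ ν : Measure α, IsProbabilityMeasure ν ∧ (∀ a, ν.real {a} = q a) ∧
      μ.map (fun ω k => s k ω) = Measure.pi fun _ => ν := by
  have hreal (k : ι) (a : α) : (μ.map (s k)).real {a} = q a := by
    rw [map_measureReal_apply (hs k) (measurableSet_singleton a), hq]
  have hprob (k : ι) : IsProbabilityMeasure (μ.map (s k)) :=
    Measure.isProbabilityMeasure_map (hs k).aemeasurable
  have hmap (k : ι) : μ.map (s k) = μ.map (s k₀) := Measure.ext_of_singleton fun a => by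
    rw [← measureReal_eq_measureReal_iff, hreal, hreal]
  refine ⟨μ.map (s k₀), hprob k₀, hreal k₀, ?_⟩
  rw [(iIndepFun_iff_map_fun_eq_pi_map fun k => (hs k).aemeasurable).1 hind]
  simp only [hmap]

namespace SoftHarmonicProblem

variable {n : ℕ} (p : SoftHarmonicProblem n)

section NormalEquations

theorem W_isSymm : p.W.IsSymm := Matrix.IsSymm.ext fun i j => p.W_symm j i

theorem lambdaMax_nonneg : 0 ≤ p.lambdaMax := by
  refine Real.sSup_nonneg fun μ hμ => ?_
  rw [Set.mem_ofPred_eq, Module.End.hasEigenvalue_iff_mem_spectrum, Matrix.spectrum_toLin'] at hμ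
  exact (Matrix.posSemidef_iff_isHermitian_and_spectrum_nonneg.1
    (weightedLaplacian_posSemidef p.W_isSymm p.W_nonneg)).2 hμ

/-- The matrix `C + L + γ I` of the normal equations. -/
noncomputable def systemMatrix (l : Set (Fin n)) : Matrix (Fin n) (Fin n) ℝ :=
  screenedLaplacian p.W fun i => p.weight l i + p.γ

/-- The solution `(C + L + γ I)⁻¹ y^l` of the normal equations. -/
noncomputable def solution (l : Set (Fin n)) : Fin n → ℝ :=
  (p.systemMatrix l)⁻¹ *ᵥ p.target l

theorem weight_add_γ_pos (l : Set (Fin n)) (i : Fin n) : 0 < p.weight l i + p.γ := by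
  have := p.cu_pos
  have := p.γ_nonneg
  unfold weight
  split_ifs <;> linarith

theorem systemMatrix_posDef (l : Set (Fin n)) : (p.systemMatrix l).PosDef :=
  screenedLaplacian_posDef p.W_isSymm p.W_nonneg (p.weight_add_γ_pos l)

theorem isUnit_det_systemMatrix (l : Set (Fin n)) : IsUnit (p.systemMatrix l).det :=
  isUnit_det_screenedLaplacian p.W_isSymm p.W_nonneg (p.weight_add_γ_pos l)

theorem systemMatrix_mulVec_solution (l : Set (Fin n)) :
    p.systemMatrix l *ᵥ p.solution l = p.target l := by
  rw [solution, Matrix.mulVec_mulVec, Matrix.mul_nonsing_inv _ (p.isUnit_det_systemMatrix l),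
    Matrix.one_mulVec]

theorem weight_mul_target (l : Set (Fin n)) (i : Fin n) :
    p.weight l i * p.target l i = p.target l i := by
  unfold weight target
  split_ifs <;> simp

theorem objective_eq (l : Set (Fin n)) (ℓ : Fin n → ℝ) :
    p.objective l ℓ =
      ℓ ⬝ᵥ p.systemMatrix l *ᵥ ℓ - 2 * (p.target l ⬝ᵥ ℓ) + p.target l ⬝ᵥ p.target l := by
  have hfit : (ℓ - p.target l) ⬝ᵥ Matrix.diagonal (p.weight l) *ᵥ (ℓ - p.target l) =
      ℓ ⬝ᵥ Matrix.diagonal (p.weight l) *ᵥ ℓ - 2 * (p.target l ⬝ᵥ ℓ) +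
        p.target l ⬝ᵥ p.target l := by
    simp only [dotProduct, Matrix.mulVec_diagonal, Pi.sub_apply, Finset.mul_sum,
      ← Finset.sum_sub_distrib, ← Finset.sum_add_distrib]
    refine Finset.sum_congr rfl fun i _ => ?_
    linear_combination (p.target l i - 2 * ℓ i) * p.weight_mul_target l i
  have hsplit : p.systemMatrix l =
      Matrix.diagonal (p.weight l) + (p.laplacian + p.γ • (1 : Matrix (Fin n) (Fin n) ℝ)) := by
    rw [systemMatrix, screenedLaplacian, ← Matrix.diagonal_add, Matrix.smul_one_eq_diagonal,
      add_assoc, add_comm (Matrix.diagonal fun _ => p.γ)]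
    rfl
  have hquad : ℓ ⬝ᵥ p.systemMatrix l *ᵥ ℓ = ℓ ⬝ᵥ Matrix.diagonal (p.weight l) *ᵥ ℓ +
      ℓ ⬝ᵥ (p.laplacian + p.γ • (1 : Matrix (Fin n) (Fin n) ℝ)) *ᵥ ℓ := by
    rw [hsplit, Matrix.add_mulVec, dotProduct_add]
  rw [objective, hfit, hquad]
  ring

theorem isSolution_iff {l : Set (Fin n)} {ℓ : Fin n → ℝ} :
    p.IsSolution l ℓ ↔ ℓ = p.solution l := by
  simp only [IsSolution, objective_eq, add_le_add_iff_right]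
  exact forall_quadratic_le_iff (p.systemMatrix_posDef l)

theorem existsUnique_isSolution (l : Set (Fin n)) : ∃! ℓ : Fin n → ℝ, p.IsSolution l ℓ :=
  ⟨p.solution l, p.isSolution_iff.2 rfl, fun _ => p.isSolution_iff.1⟩

end NormalEquations

section Green

/-- The Green function `(C + L + γ I)⁻¹ i v` of the problem with labeled set `s`: the influence that
a label at `v` has on the solution at `i`. -/
noncomputable def green (s : Finset (Fin n)) (i v : Fin n) : ℝ :=
  (p.systemMatrix s)⁻¹ i v

/-- The relative deficit `ε = (1 - c_u) / (1 + γ)` in the weight of an unlabeled vertex: its killing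
rate is `c_u + γ = (1 - ε) (1 + γ)`, that of a labeled one is `1 + γ`. -/
noncomputable def weightGap : ℝ := (1 - p.cu) * (1 + p.γ)⁻¹

theorem one_add_γ_pos : 0 < 1 + p.γ := by linarith [p.γ_nonneg]

theorem inv_one_add_γ_pos : 0 < (1 + p.γ)⁻¹ := inv_pos.2 p.one_add_γ_pos

theorem inv_one_add_γ_le_one : (1 + p.γ)⁻¹ ≤ 1 :=
  inv_le_one_of_one_le₀ (by linarith [p.γ_nonneg])

theorem weightGap_nonneg : 0 ≤ p.weightGap :=
  mul_nonneg (sub_nonneg.2 p.cu_lt_one.le) p.inv_one_add_γ_pos.le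

theorem weightGap_le : p.weightGap ≤ 1 - p.cu :=
  mul_le_of_le_one_right (sub_nonneg.2 p.cu_lt_one.le) p.inv_one_add_γ_le_one

theorem weightGap_le_one : p.weightGap ≤ 1 := p.weightGap_le.trans (by linarith [p.cu_pos])

theorem green_nonneg (s : Finset (Fin n)) (i v : Fin n) : 0 ≤ p.green s i v :=
  screenedLaplacian_inv_apply_nonneg p.W_isSymm p.W_nonneg (p.weight_add_γ_pos s) i v

theorem green_le_diag (s : Finset (Fin n)) (i v : Fin n) : p.green s i v ≤ p.green s i i :=
  screenedLaplacian_inv_apply_le_diag p.W_isSymm p.W_nonneg (p.weight_add_γ_pos s) i v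

theorem sum_green_add_sum_compl_green (s : Finset (Fin n)) (i : Fin n) :
    ∑ v ∈ s, p.green s i v + (1 - p.weightGap) * ∑ v ∈ sᶜ, p.green s i v = (1 + p.γ)⁻¹ := by
  have hγ := p.one_add_γ_pos.ne'
  have hmass : ∑ v, p.green s i v * (p.weight s v + p.γ) = 1 :=
    congrFun (screenedLaplacian_inv_mulVec_self p.W_isSymm p.W_nonneg (p.weight_add_γ_pos s)) i
  have hin : ∑ v ∈ s, p.green s i v * (p.weight s v + p.γ) =
      (∑ v ∈ s, p.green s i v) * (1 + p.γ) := by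
    rw [Finset.sum_mul]
    exact Finset.sum_congr rfl fun v hv => by rw [weight, if_pos (Finset.mem_coe.2 hv)]
  have hout : ∑ v ∈ sᶜ, p.green s i v * (p.weight s v + p.γ) =
      (∑ v ∈ sᶜ, p.green s i v) * (p.cu + p.γ) := by
    rw [Finset.sum_mul]
    exact Finset.sum_congr rfl fun v hv => by
      rw [weight, if_neg (mt Finset.mem_coe.1 (Finset.mem_compl.1 hv))]
  rw [← Finset.sum_add_sum_compl s, hin, hout] at hmass
  rw [weightGap]
  field_simp
  linear_combination hmass

theorem sum_green_le (s : Finset (Fin n)) (i : Fin n) :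
    ∑ v ∈ s, p.green s i v ≤ (1 + p.γ)⁻¹ := by
  have := mul_nonneg (sub_nonneg.2 p.weightGap_le_one)
    (Finset.sum_nonneg fun v (_ : v ∈ sᶜ) => p.green_nonneg s i v)
  linarith [p.sum_green_add_sum_compl_green s i]

theorem systemMatrix_mulVec_solution_of_subset {l s : Finset (Fin n)} (hls : l ⊆ s) (v : Fin n) :
    (p.systemMatrix s *ᵥ p.solution l) v = (if v ∈ l then p.y v else 0) +
      if v ∈ s \ l then (1 - p.cu) * p.solution l v else 0 := by
  have hv := congrFun (p.systemMatrix_mulVec_solution l) v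
  rw [systemMatrix, screenedLaplacian_mulVec] at hv ⊢
  simp only [weight, target, Finset.mem_coe, Finset.mem_sdiff] at hv ⊢
  by_cases hvl : v ∈ l
  · simp only [hvl, hls hvl, if_true, not_true, and_false, if_false] at hv ⊢
    linarith
  · by_cases hvs : v ∈ s
    · simp only [hvl, hvs, if_true, if_false, not_false_iff, and_self] at hv ⊢
      linarith
    · simp only [hvl, hvs, if_false, false_and] at hv ⊢
      linarith

theorem solution_eq_sum_green {l s : Finset (Fin n)} (hls : l ⊆ s) (i : Fin n) :
    p.solution l i = ∑ v ∈ l, p.green s i v * p.y v +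
      (1 - p.cu) * ∑ v ∈ s \ l, p.green s i v * p.solution l v := by
  have hinv : p.solution l = (p.systemMatrix s)⁻¹ *ᵥ (p.systemMatrix s *ᵥ p.solution l) := by
    rw [Matrix.mulVec_mulVec, Matrix.nonsing_inv_mul _ (p.isUnit_det_systemMatrix s),
      Matrix.one_mulVec]
  calc p.solution l i = ∑ v, p.green s i v * (p.systemMatrix s *ᵥ p.solution l) v :=
        congrFun hinv i
    _ = _ := by
      simp only [p.systemMatrix_mulVec_solution_of_subset hls, mul_add, Finset.sum_add_distrib,
        mul_ite, mul_zero, Finset.sum_ite_mem, Finset.univ_inter, Finset.mul_sum, mul_left_comm]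

theorem abs_y (i : Fin n) : |p.y i| = 1 := by
  rcases p.y_mem i with h | h <;> simp [h]

theorem y_mul_self (i : Fin n) : p.y i * p.y i = 1 := by
  rcases p.y_mem i with h | h <;> simp [h]

theorem abs_solution_le (l : Finset (Fin n)) (i : Fin n) : |p.solution l i| ≤ (1 + p.γ)⁻¹ :=
  calc |p.solution l i| = |∑ v ∈ l, p.green l i v * p.y v| := by
        rw [p.solution_eq_sum_green subset_rfl, Finset.sdiff_self, Finset.sum_empty, mul_zero,
          add_zero]
    _ ≤ ∑ v ∈ l, |p.green l i v * p.y v| := Finset.abs_sum_le_sum_abs _ _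
    _ = ∑ v ∈ l, p.green l i v := Finset.sum_congr rfl fun v _ => by
        rw [abs_mul, p.abs_y, mul_one, abs_of_nonneg (p.green_nonneg l i v)]
    _ ≤ (1 + p.γ)⁻¹ := p.sum_green_le l i

theorem abs_solution_sub_sum_green_le {l s : Finset (Fin n)} (hls : l ⊆ s) (i : Fin n) :
    |p.solution l i - ∑ v ∈ l, p.green s i v * p.y v| ≤
      p.weightGap * ∑ v ∈ s \ l, p.green s i v := by
  have hcu : 0 ≤ 1 - p.cu := sub_nonneg.2 p.cu_lt_one.le
  rw [p.solution_eq_sum_green hls i, add_sub_cancel_left, abs_mul, abs_of_nonneg hcu, weightGap,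
    mul_assoc, Finset.mul_sum]
  refine mul_le_mul_of_nonneg_left ((Finset.abs_sum_le_sum_abs _ _).trans
    (Finset.sum_le_sum fun v _ => ?_)) hcu
  rw [abs_mul, abs_of_nonneg (p.green_nonneg s i v), mul_comm]
  exact mul_le_mul_of_nonneg_right (p.abs_solution_le l v) (p.green_nonneg s i v)

end Green

section Cost

theorem cost_eq (u : Fin n → ℝ) (i : Fin n) : p.cost u i = (1 - p.y i * u i) ^ 2 := by
  rw [cost]
  linear_combination (1 - u i ^ 2) * p.y_mul_self i

theorem y_mul_solution_mem_Icc (l : Finset (Fin n)) (i : Fin n) :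
    p.y i * p.solution l i ∈ Set.Icc (-1) 1 := by
  rw [Set.mem_Icc, ← abs_le, abs_mul, p.abs_y, one_mul]
  exact (p.abs_solution_le l i).trans p.inv_one_add_γ_le_one

theorem cost_solution_mem_Icc (l : Set (Fin n)) (i : Fin n) :
    p.cost (p.solution l) i ∈ Set.Icc 0 4 := by
  lift l to Finset (Fin n) using l.toFinite
  obtain ⟨hlo, hhi⟩ := p.y_mul_solution_mem_Icc l i
  rw [cost_eq]
  exact ⟨sq_nonneg _, by nlinarith⟩

theorem abs_y_mul_y (i v : Fin n) : |p.y i * p.y v| = 1 := by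
  rw [abs_mul, p.abs_y, p.abs_y, one_mul]

theorem abs_sum_green_mul_le (s t : Finset (Fin n)) (i : Fin n) :
    |∑ v ∈ t, p.green s i v * (p.y i * p.y v)| ≤ ∑ v ∈ t, p.green s i v :=
  (Finset.abs_sum_le_sum_abs _ _).trans_eq (Finset.sum_congr rfl fun v _ => by
    rw [abs_mul, p.abs_y_mul_y, mul_one, abs_of_nonneg (p.green_nonneg s i v)])

theorem abs_y_mul_solution_sub_sum_green_le {l s : Finset (Fin n)} (hls : l ⊆ s) (i : Fin n) :
    |p.y i * p.solution l i - ∑ v ∈ l, p.green s i v * (p.y i * p.y v)| ≤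
      p.weightGap * ∑ v ∈ s \ l, p.green s i v := by
  have hfactor : ∑ v ∈ l, p.green s i v * (p.y i * p.y v) =
      p.y i * ∑ v ∈ l, p.green s i v * p.y v := by
    simp only [Finset.mul_sum, mul_left_comm]
  rw [hfactor, ← mul_sub, abs_mul, p.abs_y, one_mul]
  exact p.abs_solution_sub_sum_green_le hls i

theorem one_sub_weightGap_mul_green_diag_le (s t : Finset (Fin n)) (i : Fin n) :
    (1 - p.weightGap) * p.green s i i ≤ ∑ v ∈ t, p.green s i v * (1 + p.y i * p.y v) +
      (1 - p.weightGap) * ∑ v ∈ tᶜ, p.green s i v := by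
  have hε := p.weightGap_nonneg
  have hε' : 0 ≤ 1 - p.weightGap := sub_nonneg.2 p.weightGap_le_one
  have hterm : ∀ v ∈ t, 0 ≤ p.green s i v * (1 + p.y i * p.y v) := fun v _ =>
    mul_nonneg (p.green_nonneg s i v) (by linarith [neg_le_of_abs_le (p.abs_y_mul_y i v).le])
  by_cases hi : i ∈ t
  · have hdiag := Finset.single_le_sum hterm hi
    rw [p.y_mul_self] at hdiag
    have hout := mul_nonneg hε' (Finset.sum_nonneg fun v (_ : v ∈ tᶜ) => p.green_nonneg s i v)
    nlinarith [p.green_nonneg s i i]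
  · have hdiag := Finset.single_le_sum (fun v _ => p.green_nonneg s i v) (Finset.mem_compl.2 hi)
    exact (mul_le_mul_of_nonneg_left hdiag hε').trans
      (le_add_of_nonneg_left (Finset.sum_nonneg hterm))

theorem sum_green_inter_add_sdiff (l l' : Finset (Fin n)) (i : Fin n) :
    ∑ v ∈ l ∩ l', p.green (l ∪ l') i v + ∑ v ∈ l \ l', p.green (l ∪ l') i v +
      ∑ v ∈ l' \ l, p.green (l ∪ l') i v +
      (1 - p.weightGap) * ∑ v ∈ (l ∪ l')ᶜ, p.green (l ∪ l') i v = (1 + p.γ)⁻¹ := by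
  rw [← p.sum_green_add_sum_compl_green (l ∪ l') i, Finset.sum_inter_add_sum_sdiff,
    ← Finset.sum_union Finset.disjoint_sdiff, Finset.union_sdiff_self_eq_union]

theorem y_mul_solution_le (l l' : Finset (Fin n)) (i : Fin n) :
    p.y i * p.solution l i ≤
      ∑ v ∈ l ∩ l', p.green (l ∪ l') i v * (p.y i * p.y v) +
        ∑ v ∈ l \ l', p.green (l ∪ l') i v +
        p.weightGap * ∑ v ∈ l' \ l, p.green (l ∪ l') i v := by
  have hsol := le_of_abs_le
    (p.abs_y_mul_solution_sub_sum_green_le (Finset.subset_union_left (s₁ := l) (s₂ := l')) i)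
  have hold := le_of_abs_le (p.abs_sum_green_mul_le (l ∪ l') (l \ l') i)
  rw [← Finset.sum_inter_add_sum_sdiff l l', Finset.union_sdiff_left] at hsol
  linarith

theorem le_y_mul_solution (l l' : Finset (Fin n)) (i : Fin n) :
    ∑ v ∈ l ∩ l', p.green (l ∪ l') i v * (p.y i * p.y v) +
        ∑ v ∈ l' \ l, p.green (l ∪ l') i v * (p.y i * p.y v) -
        p.weightGap * ∑ v ∈ l \ l', p.green (l ∪ l') i v ≤ p.y i * p.solution l' i := by
  have hsol := neg_le_of_abs_le
    (p.abs_y_mul_solution_sub_sum_green_le (Finset.subset_union_right (s₁ := l) (s₂ := l')) i)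
  rw [← Finset.sum_inter_add_sum_sdiff l' l, Finset.union_sdiff_right, Finset.inter_comm]
    at hsol
  linarith

theorem neg_one_sub_weightGap_mul_le {l l' : Finset (Fin n)} (h : (l' \ l).card ≤ 1) (i : Fin n) :
    -((1 - p.weightGap) * (∑ v ∈ l \ l', p.green (l ∪ l') i v +
          ∑ v ∈ (l ∪ l')ᶜ, p.green (l ∪ l') i v)) ≤
      ∑ v ∈ l ∩ l', p.green (l ∪ l') i v +
        ∑ v ∈ l ∩ l', p.green (l ∪ l') i v * (p.y i * p.y v) +
        ∑ v ∈ l' \ l, p.green (l ∪ l') i v * (p.y i * p.y v) +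
        p.weightGap * ∑ v ∈ l' \ l, p.green (l ∪ l') i v := by
  -- The diagonal Green function dominates the influence of the single new vertex, and it is
  -- controlled because the label of `i` agrees with itself.
  have hdiag := p.one_sub_weightGap_mul_green_diag_le (l ∪ l') l' i
  have hcompl : l'ᶜ = l \ l' ∪ (l ∪ l')ᶜ := by
    ext v
    simp only [Finset.mem_compl, Finset.mem_union, Finset.mem_sdiff]
    tauto
  have hdisj : Disjoint (l \ l') (l ∪ l')ᶜ :=
    disjoint_compl_right.mono_left (Finset.sdiff_subset.trans Finset.subset_union_left)
  have hnew : ∑ v ∈ l' \ l, p.green (l ∪ l') i v ≤ p.green (l ∪ l') i i :=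
    (Finset.sum_le_card_nsmul _ _ _ fun v _ => p.green_le_diag _ i v).trans
      ((nsmul_le_nsmul_left (p.green_nonneg _ i i) h).trans_eq (one_nsmul _))
  rw [hcompl, Finset.sum_union hdisj, ← Finset.sum_inter_add_sum_sdiff l' l, Finset.inter_comm l']
    at hdiag
  simp only [mul_one_add, Finset.sum_add_distrib] at hdiag
  linarith [mul_le_mul_of_nonneg_left hnew (sub_nonneg.2 p.weightGap_le_one)]

theorem cost_solution_sub_le {l l' : Finset (Fin n)} (h : (l' \ l).card ≤ 1) (i : Fin n) :
    p.cost (p.solution l') i - p.cost (p.solution l) i ≤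
      2 * (1 + p.weightGap) * (1 + p.γ)⁻¹ := by
  have hmass := p.sum_green_inter_add_sdiff l l' i
  have hsum := p.neg_one_sub_weightGap_mul_le h i
  have hcommon := abs_le.1 (p.abs_sum_green_mul_le (l ∪ l') (l ∩ l') i)
  have hnew := neg_le_of_abs_le (p.abs_sum_green_mul_le (l ∪ l') (l' \ l) i)
  have hG (t : Finset (Fin n)) : 0 ≤ ∑ v ∈ t, p.green (l ∪ l') i v :=
    Finset.sum_nonneg fun v _ => p.green_nonneg _ i v
  have hO := mul_nonneg (sub_nonneg.2 p.weightGap_le_one) (hG (l ∪ l')ᶜ)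
  have hεB := mul_le_of_le_one_left (hG (l' \ l)) p.weightGap_le_one
  have hm := p.inv_one_add_γ_le_one
  rw [p.cost_eq, p.cost_eq]
  refine one_sub_sq_sub_one_sub_sq_le (p.y_mul_solution_le l l' i) ?_ (p.le_y_mul_solution l l' i)
    (p.y_mul_solution_mem_Icc l' i).2 ?_ hm (add_nonneg (hG (l \ l')) (hG (l' \ l)))
    p.weightGap_nonneg ?_ ?_
  · linarith [hcommon.2]
  · linarith [hG (l ∩ l')]
  · linarith
  · linarith [hcommon.1]

end Cost

section Stability

theorem le_of_mem_costChanges {nl : ℕ} {r : ℝ} (hr : r ∈ p.costChanges nl) :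
    r ≤ 2 * (1 + p.weightGap) * (1 + p.γ)⁻¹ := by
  obtain ⟨S, S', u, u', i, ⟨k, hk⟩, hu, hu', rfl⟩ := hr
  have hrange (S : Fin nl → Fin n) : Set.range S = Finset.univ.image S := by simp
  rw [hrange, isSolution_iff] at hu hu'
  rw [hu, hu', abs_sub_le_iff]
  exact ⟨p.cost_solution_sub_le (card_image_sdiff_image_le_one fun j hj => (hk j hj).symm) i,
    p.cost_solution_sub_le (card_image_sdiff_image_le_one hk) i⟩

variable {nl : ℕ} (hn : 0 < n) (hnl : 0 < nl)
include hn hnl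

theorem zero_mem_costChanges : 0 ∈ p.costChanges nl :=
  ⟨_, fun _ => ⟨0, hn⟩, _, _, ⟨0, hn⟩, ⟨⟨0, hnl⟩, fun _ _ => rfl⟩, p.isSolution_iff.2 rfl,
    p.isSolution_iff.2 rfl, by rw [sub_self, abs_zero]⟩

theorem isLUB_stability : IsLUB (p.costChanges nl) (p.stability nl) :=
  isLUB_csSup ⟨0, p.zero_mem_costChanges hn hnl⟩ ⟨_, fun _ => p.le_of_mem_costChanges⟩

theorem stability_nonneg : 0 ≤ p.stability nl :=
  (p.isLUB_stability hn hnl).1 (p.zero_mem_costChanges hn hnl)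

theorem stability_le : p.stability nl ≤ 2 * (1 + p.weightGap) * (1 + p.γ)⁻¹ :=
  (p.isLUB_stability hn hnl).2 fun _ => p.le_of_mem_costChanges

theorem stability_le_four_div : p.stability nl ≤ 4 / (p.γ + 1) := by
  refine (p.stability_le hn hnl).trans ?_
  rw [div_eq_mul_inv, add_comm p.γ 1]
  refine mul_le_mul_of_nonneg_right ?_ p.inv_one_add_γ_pos.le
  linarith [p.weightGap_le_one]

end Stability

section StabilityBound

theorem sqrt_cu_pos : 0 < √p.cu := Real.sqrt_pos.2 p.cu_pos

theorem sqrt_cu_le_one : √p.cu ≤ 1 := Real.sqrt_le_one.2 p.cu_lt_one.le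

theorem one_sub_sqrt_cu_div_nonneg : 0 ≤ (1 - √p.cu) / √p.cu :=
  div_nonneg (sub_nonneg.2 p.sqrt_cu_le_one) p.sqrt_cu_pos.le

theorem lambdaMax_add_γ_div_nonneg : 0 ≤ (p.lambdaMax + p.γ) / (p.γ ^ 2 + 1) :=
  div_nonneg (add_nonneg p.lambdaMax_nonneg p.γ_nonneg) (by positivity)

theorem two_mul_div_le_stabilityBound (nl : ℕ) (a : ℝ) :
    2 * (a / (p.γ + 1)) ≤ p.stabilityBound nl a := by
  have hterm := mul_nonneg (mul_nonneg (Real.sqrt_nonneg (2 * (nl : ℝ)))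
    p.one_sub_sqrt_cu_div_nonneg) p.lambdaMax_add_γ_div_nonneg
  rw [stabilityBound]
  linarith

theorem stability_le_stabilityBound_two {nl : ℕ} (hn : 0 < n) (hnl : 0 < nl) :
    p.stability nl ≤ p.stabilityBound nl 2 :=
  calc p.stability nl ≤ 4 / (p.γ + 1) := p.stability_le_four_div hn hnl
    _ = 2 * (2 / (p.γ + 1)) := by ring
    _ ≤ p.stabilityBound nl 2 := p.two_mul_div_le_stabilityBound nl 2

theorem inv_one_add_γ_le_of_one_le (h : 1 ≤ p.lambdaMax + p.γ) :
    (1 + p.γ)⁻¹ ≤ (p.lambdaMax + p.γ) / (p.γ ^ 2 + 1) := by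
  rw [inv_eq_one_div, div_le_div_iff₀ p.one_add_γ_pos (by positivity)]
  nlinarith [mul_nonneg p.lambdaMax_nonneg p.γ_nonneg]

theorem stability_le_stabilityBound_sqrt_two {nl : ℕ} (hn : 0 < n) (hnl : 0 < nl)
    (h : 1 ≤ p.lambdaMax + p.γ) : p.stability nl ≤ p.stabilityBound nl √2 := by
  have hroot : √2 ≤ √(2 * (nl : ℝ)) :=
    Real.sqrt_le_sqrt (le_mul_of_one_le_right zero_le_two (Nat.one_le_cast.2 hnl))
  have hterm : √2 * ((1 - √p.cu) / √p.cu) * (1 + p.γ)⁻¹ ≤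
      √(2 * (nl : ℝ)) * ((1 - √p.cu) / √p.cu) * ((p.lambdaMax + p.γ) / (p.γ ^ 2 + 1)) :=
    mul_le_mul (mul_le_mul_of_nonneg_right hroot p.one_sub_sqrt_cu_div_nonneg)
      (p.inv_one_add_γ_le_of_one_le h) p.inv_one_add_γ_pos.le
      (mul_nonneg (Real.sqrt_nonneg _) p.one_sub_sqrt_cu_div_nonneg)
  have hcu : 1 + p.weightGap ≤ √2 / √p.cu := by
    have hsqrt := two_sub_sq_le_sqrt_two_div p.sqrt_cu_pos p.sqrt_cu_le_one
    rw [Real.sq_sqrt p.cu_pos.le] at hsqrt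
    linarith [p.weightGap_le]
  have hcu0 := p.sqrt_cu_pos
  have hγ := p.one_add_γ_pos
  calc p.stability nl ≤ 2 * (1 + p.weightGap) * (1 + p.γ)⁻¹ := p.stability_le hn hnl
    _ ≤ 2 * (√2 / √p.cu) * (1 + p.γ)⁻¹ := by gcongr
    _ = 2 * (√2 / (p.γ + 1) + √2 * ((1 - √p.cu) / √p.cu) * (1 + p.γ)⁻¹) := by
      rw [add_comm p.γ 1]
      field_simp
      ring
    _ ≤ p.stabilityBound nl √2 := by
      rw [stabilityBound]
      gcongr

end StabilityBound

section Rate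

variable {nl : ℕ} {κ : ℝ}

theorem stability_le_div (hκ : 0 < κ) (hn : 0 < n) (hnl : 0 < nl)
    (h : κ * (nl : ℝ) ^ (3 / 2 : ℝ) ≤ p.γ) : p.stability nl ≤ 4 / κ / nl :=
  calc p.stability nl ≤ 4 / (p.γ + 1) := p.stability_le_four_div hn hnl
    _ ≤ 4 / (κ * nl) := by
      have := mul_le_of_mul_rpow_le hκ.le (Nat.one_le_cast.2 hnl) h
      gcongr
      linarith
    _ = 4 / κ / nl := (div_div _ _ _).symm

theorem lambdaMax_add_γ_div_le {M : ℝ} (hγ : 0 < p.γ) (hM : p.lambdaMax ≤ M * p.γ) :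
    (p.lambdaMax + p.γ) / (p.γ ^ 2 + 1) ≤ (M + 1) / p.γ := by
  have hM0 : 0 ≤ M := nonneg_of_mul_nonneg_left (p.lambdaMax_nonneg.trans hM) hγ
  rw [div_le_div_iff₀ (by positivity) hγ]
  nlinarith

theorem stabilityBound_sqrt_two_le_div {c M : ℝ} (hκ : 0 < κ) (hc : 0 < c) (hnl : 0 < nl)
    (hcu : c ≤ p.cu) (hM : p.lambdaMax ≤ M * p.γ) (h : κ * (nl : ℝ) ^ (3 / 2 : ℝ) ≤ p.γ) :
    p.stabilityBound nl √2 ≤ 2 * √2 * (1 + (M + 1) / √c) / κ / nl := by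
  have hnl' : (0 : ℝ) < nl := Nat.cast_pos.2 hnl
  have hle := mul_le_of_mul_rpow_le hκ.le (Nat.one_le_cast.2 hnl) h
  have hγ : 0 < p.γ := (by positivity : 0 < κ * nl).trans_le hle
  have hM0 : 0 ≤ M := nonneg_of_mul_nonneg_left (p.lambdaMax_nonneg.trans hM) hγ
  have hcu' : (1 - √p.cu) / √p.cu ≤ 1 / √c :=
    div_le_div₀ zero_le_one (by linarith [p.sqrt_cu_pos]) (Real.sqrt_pos.2 hc)
      (Real.sqrt_le_sqrt hcu)
  have hratio0 := p.lambdaMax_add_γ_div_nonneg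
  have hterm : √(2 * (nl : ℝ)) * ((1 - √p.cu) / √p.cu) * ((p.lambdaMax + p.γ) / (p.γ ^ 2 + 1)) ≤
      √2 * ((M + 1) / √c) * (1 / (κ * nl)) :=
    calc _ ≤ √(2 * (nl : ℝ)) * (1 / √c) * ((M + 1) / p.γ) := by
          gcongr ?_ * ?_
          · gcongr
          · exact p.lambdaMax_add_γ_div_le hγ hM
      _ = √2 * ((M + 1) / √c) * (√(nl : ℝ) / p.γ) := by
          rw [Real.sqrt_mul zero_le_two]
          ring
      _ ≤ √2 * ((M + 1) / √c) * (1 / (κ * nl)) := by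
          gcongr ?_ * ?_
          exact sqrt_div_le_of_mul_rpow_le hκ hnl' h
  calc p.stabilityBound nl √2
      ≤ 2 * (√2 / (κ * nl) + √2 * ((M + 1) / √c) * (1 / (κ * nl))) := by
        rw [stabilityBound]
        gcongr
        linarith
    _ = 2 * √2 * (1 + (M + 1) / √c) / κ / nl := by ring

end Rate

section Risk

theorem empiricalRisk_nonneg {nl : ℕ} (S : Fin nl → Fin n) (u : Fin n → ℝ) :
    0 ≤ p.empiricalRisk S u :=
  mul_nonneg (by positivity) (Finset.sum_nonneg fun _ _ => sq_nonneg _)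

theorem risk_solution_le_four (hn : 0 < n) (l : Set (Fin n)) : p.risk (p.solution l) ≤ 4 := by
  rw [risk, one_div_mul_eq_div, div_le_iff₀ (Nat.cast_pos.2 hn)]
  calc ∑ i, p.cost (p.solution l) i ≤ ∑ _ : Fin n, (4 : ℝ) :=
        Finset.sum_le_sum fun i _ => (p.cost_solution_mem_Icc l i).2
    _ = 4 * n := by simp [mul_comm]

theorem generalizationGap_cost_solution {nl : ℕ} {ν : Measure (Fin n)} [IsFiniteMeasure ν]
    (hν : ∀ i, ν.real {i} = 1 / (n : ℝ)) (S : Fin nl → Fin n) :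
    generalizationGap (fun S i => p.cost (p.solution (Set.range S)) i) ν S =
      p.risk (p.solution (Set.range S)) - p.empiricalRisk S (p.solution (Set.range S)) := by
  rw [generalizationGap, risk, empiricalRisk, integral_eq_mul_sum_of_measureReal_singleton hν,
    Fintype.card_fin]

variable {nl : ℕ} (hn : 0 < n) (hnl : 0 < nl)
include hn hnl

theorem uniformlyStable_cost_solution :
    UniformlyStable (fun (S : Fin nl → Fin n) i => p.cost (p.solution (Set.range S)) i)
      ⟨p.stability nl, p.stability_nonneg hn hnl⟩ :=
  fun S S' h i => (p.isLUB_stability hn hnl).1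
    ⟨S, S', _, _, i, h, p.isSolution_iff.2 rfl, p.isSolution_iff.2 rfl, rfl⟩

theorem measureReal_risk_sub_empiricalRisk_ge_le {ν : Measure (Fin n)} [IsProbabilityMeasure ν]
    (hν : ∀ i, ν.real {i} = 1 / (n : ℝ)) {r : ℝ} (hr : 0 ≤ r) :
    (Measure.pi fun _ : Fin nl => ν).real
        {S | p.stability nl + (2 * p.stability nl + 4 / nl) * √(nl * r / 2) ≤
          p.risk (p.solution (Set.range S)) - p.empiricalRisk S (p.solution (Set.range S))} ≤
      Real.exp (-r) := by
  have : NeZero nl := ⟨hnl.ne'⟩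
  simp only [← p.generalizationGap_cost_solution hν]
  exact measureReal_generalizationGap_ge_le (M := 4) (p.uniformlyStable_cost_solution hn hnl)
    (measurable_of_finite _) (fun S => p.cost_solution_mem_Icc (Set.range S)) four_pos hr

variable {Ω : Type*} [MeasurableSpace Ω] {μ : Measure Ω} [IsProbabilityMeasure μ]
  {s : Fin nl → Ω → Fin n} (hs : ∀ k, Measurable (s k)) (hind : iIndepFun s μ)
  (hunif : ∀ k i, μ.real (s k ⁻¹' {i}) = 1 / (n : ℝ)) {δ : ℝ} (hδ0 : 0 < δ) (hδ1 : δ < 1)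
include hs hind hunif hδ0 hδ1

theorem one_sub_le_measureReal_risk_le :
    1 - δ ≤ μ.real {ω | ∀ u : Fin n → ℝ, p.IsSolution (Set.range fun k => s k ω) u →
      p.risk u ≤ p.empiricalRisk (fun k => s k ω) u +
        transductiveError (p.stability nl) nl δ} := by
  obtain ⟨ν, _, hν, hlaw⟩ := exists_map_eq_pi_of_iIndepFun hs hind hunif ⟨0, hnl⟩
  have hmeas : Measurable fun ω k => s k ω := measurable_pi_lambda _ hs
  let B : Set (Fin nl → Fin n) := {S | p.stability nl + (2 * p.stability nl + 4 / nl) *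
    √(nl * Real.log (2 / δ) / 2) ≤
      p.risk (p.solution (Set.range S)) - p.empiricalRisk S (p.solution (Set.range S))}
  have hB : MeasurableSet B := B.toFinite.measurableSet
  have hbad : μ.real ((fun ω k => s k ω) ⁻¹' B) ≤ δ :=
    calc μ.real ((fun ω k => s k ω) ⁻¹' B) = (Measure.pi fun _ => ν).real B := by
          rw [← hlaw, map_measureReal_apply hmeas hB]
      _ ≤ Real.exp (-Real.log (2 / δ)) := p.measureReal_risk_sub_empiricalRisk_ge_le hn hnl hν
          (Real.log_nonneg (by rw [le_div_iff₀ hδ0]; linarith))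
      _ = δ / 2 := by rw [Real.exp_neg, Real.exp_log (by positivity), inv_div]
      _ ≤ δ := half_le_self hδ0.le
  calc 1 - δ ≤ 1 - μ.real ((fun ω k => s k ω) ⁻¹' B) := by linarith
    _ = μ.real ((fun ω k => s k ω) ⁻¹' B)ᶜ := (probReal_compl_eq_one_sub (hmeas hB)).symm
    _ ≤ _ := by
      refine measureReal_mono fun ω hω u hu => ?_
      simp only [B, Set.mem_compl_iff, Set.mem_preimage, Set.mem_ofPred_eq, not_le] at hω
      rw [p.isSolution_iff.1 hu]
      linarith [mcdiarmid_threshold_le_transductiveError (p.stability nl) hnl (δ := δ)]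

theorem one_sub_le_measureReal_risk_le_stabilityBound :
    1 - δ ≤ μ.real {ω | ∀ u : Fin n → ℝ, p.IsSolution (Set.range fun k => s k ω) u →
      p.risk u ≤ p.empiricalRisk (fun k => s k ω) u +
        transductiveError (p.stabilityBound nl √2) nl δ} := by
  by_cases h : 1 ≤ p.lambdaMax + p.γ
  · refine (p.one_sub_le_measureReal_risk_le hn hnl hs hind hunif hδ0 hδ1).trans
      (measureReal_mono fun ω hω u hu => (hω u hu).trans ?_)
    gcongr
    exact transductiveError_mono (p.stability_le_stabilityBound_sqrt_two hn hnl h) nl δ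
  · -- Here `γ < 1`, so the error term is at least `4` and the event is certain.
    have hbound : 1 ≤ p.stabilityBound nl √2 := by
      refine le_trans ?_ (p.two_mul_div_le_stabilityBound nl √2)
      rw [mul_div_assoc', le_div_iff₀ (by linarith [p.γ_nonneg])]
      linarith [p.lambdaMax_nonneg, Real.one_le_sqrt.2 (one_le_two (α := ℝ))]
    have hcertain : {ω | ∀ u : Fin n → ℝ, p.IsSolution (Set.range fun k => s k ω) u →
        p.risk u ≤ p.empiricalRisk (fun k => s k ω) u +
          transductiveError (p.stabilityBound nl √2) nl δ} = Set.univ :=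
      Set.eq_univ_of_forall fun ω u hu => by
        rw [p.isSolution_iff.1 hu]
        linarith [p.risk_solution_le_four hn (Set.range fun k => s k ω),
          p.empiricalRisk_nonneg (fun k => s k ω) (p.solution (Set.range fun k => s k ω)),
          four_le_transductiveError hbound hnl hδ0 hδ1]
    rw [hcertain, probReal_univ]
    linarith

end Risk

end SoftHarmonicProblem

theorem mainTheorem3 :
    -- the bounds for a fixed problem
    (∀ (n nl : ℕ) (_ : 0 < n) (_ : 0 < nl) (p : SoftHarmonicProblem n),
      -- the solution exists and is unique, and `β` is a genuine supremum
      (∀ l : Set (Fin n), ∃! ℓ : Fin n → ℝ, p.IsSolution l ℓ) ∧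
      IsLUB (p.costChanges nl) (p.stability nl) ∧
      -- explicit bounds on the stability coefficient
      p.stability nl ≤ p.stabilityBound nl 2 ∧
      (1 ≤ p.lambdaMax + p.γ → p.stability nl ≤ p.stabilityBound nl √2) ∧
      -- the risk bound for i.i.d. uniformly distributed labeled examples `s 0, …, s (nl - 1)`
      (∀ (Ω : Type*) [MeasurableSpace Ω] (μ : Measure Ω) [IsProbabilityMeasure μ]
        (s : Fin nl → Ω → Fin n) (_ : ∀ k, Measurable (s k)) (_ : iIndepFun s μ)
        (_ : ∀ k i, μ.real (s k ⁻¹' {i}) = 1 / (n : ℝ)) (δ : ℝ) (_ : 0 < δ) (_ : δ < 1),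
        1 - δ ≤ μ.real {ω | ∀ ℓ : Fin n → ℝ, p.IsSolution (Set.range fun k => s k ω) ℓ →
          p.risk ℓ ≤ p.empiricalRisk (fun k => s k ω) ℓ +
            transductiveError (p.stability nl) nl δ} ∧
        1 - δ ≤ μ.real {ω | ∀ ℓ : Fin n → ℝ, p.IsSolution (Set.range fun k => s k ω) ℓ →
          p.risk ℓ ≤ p.empiricalRisk (fun k => s k ω) ℓ +
            transductiveError (p.stabilityBound nl √2) nl δ})) ∧
    -- `β = O(1 / nl)` when `γ = Ω(nl ^ (3 / 2))`
    (∀ κ : ℝ, 0 < κ → ∃ K : ℝ, ∀ (n nl : ℕ) (_ : 0 < n) (_ : 0 < nl) (p : SoftHarmonicProblem n),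
      κ * (nl : ℝ) ^ (3 / 2 : ℝ) ≤ p.γ → p.stability nl ≤ K / (nl : ℝ)) ∧
    -- the same rate for the explicit bound
    (∀ κ c M : ℝ, 0 < κ → 0 < c → ∃ K : ℝ,
      ∀ (n nl : ℕ) (_ : 0 < n) (_ : 0 < nl) (p : SoftHarmonicProblem n),
      c ≤ p.cu → p.lambdaMax ≤ M * p.γ → κ * (nl : ℝ) ^ (3 / 2 : ℝ) ≤ p.γ →
      p.stabilityBound nl √2 ≤ K / (nl : ℝ)) := by
  refine ⟨fun n nl hn hnl p => ⟨p.existsUnique_isSolution, p.isLUB_stability hn hnl,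
    p.stability_le_stabilityBound_two hn hnl, p.stability_le_stabilityBound_sqrt_two hn hnl, ?_⟩,
    fun κ hκ => ⟨4 / κ, fun n nl hn hnl p h => p.stability_le_div hκ hn hnl h⟩,
    fun κ c M hκ hc => ⟨2 * √2 * (1 + (M + 1) / √c) / κ, fun n nl _ hnl p hcu hM h =>
      p.stabilityBound_sqrt_two_le_div hκ hc hnl hcu hM h⟩⟩
  intro Ω _ μ _ s hs hind hunif δ hδ0 hδ1
  exact ⟨p.one_sub_le_measureReal_risk_le hn hnl hs hind hunif hδ0 hδ1,
    p.one_sub_le_measureReal_risk_le_stabilityBound hn hnl hs hind hunif hδ0 hδ1⟩
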